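/- Let $p$ be a prime, $N\in\mathbb{N}$, $\mathcal{A}_N=\{1,\dots,N\}$, and let $w=a_1a_2a_3\ldots\in\mathcal{A}_N^{\mathbb{N}}$ be an infinite word that is non-periodic and uniformly recurrent, i.e. every factor (finite block) $u$ of $w$ occurs infinitely often in $w$, and the distance between any two consecutive occurrences of $u$ is bounded by a constant $d=d(u)$. For each $n$ let $G_n$ be the bipartite graph whose two vertex classes $S_n$ and $T_n$ are disjoint copies of the set of factors of $w$ of length $n$, in which $s\in S_n$ and $t\in T_n$ are joined by an edge if and only if the concatenation $st$ is a factor of $w$. For $a\in\mathbb{N}$ put $A_a=\begin{pmatrix}0&1\\1&a\end{pmatrix}$. For an infinite word $v=b_1b_2b_3\ldots$ over the positive integers and a point $\mathbf q\in\mathbf{P}^1_{\mathbb{Q}_p}$ (regarded as a column of homogeneous coordinates) put $\mathrm{T}(v,\mathbf q)=(b_2b_3\ldots,\,A_{b_1}\mathbf q)$. For $\epsilon>0$ let $\mathbf{PBad}_\epsilon$ be the set of points $(q_1,q_2)\in\mathbf{P}^1_{\mathbb{Q}_p}$ such that $$|aq_1+bq_2|_p\cdot\min\{|q_1|_p^{-1},|q_2|_p^{-1}\}\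 \ge\ \epsilon\cdot\min\{|a|^{-2},|b|^{-2}\}\qquad\text{for all }(a,b)\in\mathbb{Z}^2\setminus\{(0,0)\},$$ where the inverse of $0$ is read as $+\infty$. Let $\mathbf{LMad}$ be the set of pairs $(v,\mathbf x_p)$ for which there is an $\epsilon>0$ such that $\mathrm{T}^n(v,\mathbf x_p)\in\mathcal{A}_M^{\mathbb{N}}\times\mathbf{PBad}_\epsilon$ for every $n\ge 0$, where $M=\lfloor\epsilon^{-1}\rfloor+1$. If the number of connected components of $G_n$ is bounded by a constant independent of $n$, then $(w,\mathbf x_p)\notin\mathbf{LMad}$ for every $\mathbf x_p\in\mathbf{P}^1_{\mathbb{Q}_p}$. -/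

import Mathlib

namespace LimitWords

/-! ### Infinite words -/

/-- The finite alphabet `{1, 2, …, N}`. -/
def alphabet (N : ℕ) : Set ℕ := Set.Icc 1 N

/-- The set of infinite words over the alphabet `{1, …, N}`.
An infinite word `a₁ a₂ a₃ …` is the function `w : ℕ → ℕ` with `w i = a_{i+1}`. -/
def wordsOver (N : ℕ) : Set (ℕ → ℕ) := {w | ∀ i, w i ∈ alphabet N}

/-- The left shift on infinite words. -/
def shift (w : ℕ → ℕ) : ℕ → ℕ := fun i => w (i + 1)

/-- The finite word `u` occurs in the infinite word `w` at position `i`. -/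
def OccursAt (w : ℕ → ℕ) (u : List ℕ) (i : ℕ) : Prop :=
  ∀ (j : ℕ) (hj : j < u.length), w (i + j) = u[j]

/-- The finite word `u` is a factor of the infinite word `w`. -/
def IsFactor (w : ℕ → ℕ) (u : List ℕ) : Prop := ∃ i, OccursAt w u i

/-- `w` is (purely) periodic. -/
def IsPeriodic (w : ℕ → ℕ) : Prop := ∃ l : ℕ, 0 < l ∧ Function.Periodic w l

/-- `w` is recurrent: every factor of `w` occurs infinitely often in `w`. -/
def IsRecurrent (w : ℕ → ℕ) : Prop :=
  ∀ u : List ℕ, IsFactor w u → {i | OccursAt w u i}.Infinite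

/-- `w` is uniformly recurrent: it is recurrent, and for each factor `u` the distance between
any two consecutive occurrences of `u` in `w` is at most a constant `d = d(u)`. -/
def IsUniformlyRecurrent (w : ℕ → ℕ) : Prop :=
  IsRecurrent w ∧
    ∀ u : List ℕ, IsFactor w u → ∃ d : ℕ, ∀ i j : ℕ, i < j →
      OccursAt w u i → OccursAt w u j → (∀ k, i < k → k < j → ¬ OccursAt w u k) →
        j - i ≤ d

/-! ### The bipartite graphs of a word -/

/-- The set of factors of `w` of length `n`. -/
def factors (w : ℕ → ℕ) (n : ℕ) : Set (List ℕ) := {u | u.length = n ∧ IsFactor w u}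

/-- The bipartite graph `G_n`: its two vertex classes are two disjoint copies of the set of factors
of `w` of length `n`; the vertex `s` of the first copy and the vertex `t` of the second one are
linked iff the concatenation `st` is a factor of `w`, and there are no other edges. -/
def factorGraph (w : ℕ → ℕ) (n : ℕ) : SimpleGraph (factors w n ⊕ factors w n) where
  Adj x y :=
    (∃ s t : factors w n, x = Sum.inl s ∧ y = Sum.inr t ∧ IsFactor w (s.1 ++ t.1)) ∨
    (∃ s t : factors w n, y = Sum.inl s ∧ x = Sum.inr t ∧ IsFactor w (s.1 ++ t.1))
  symm := ⟨fun _ _ h => h.symm⟩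
  loopless := ⟨by
    rintro x (⟨s, t, h1, h2, -⟩ | ⟨s, t, h1, h2, -⟩) <;> rw [h1] at h2 <;> cases h2⟩

/-! ### The projective line over `ℚ_p` and the extended shift -/

section Padic

variable (p : ℕ) [Fact p.Prime]

/-- The projective line over `ℚ_p`. -/
abbrev PLine : Type := Projectivization ℚ_[p] (Fin 2 → ℚ_[p])

/-- The matrix `A_a` with rows `(0, 1)` and `(1, a)`. -/
noncomputable def matA (a : ℕ) : Matrix (Fin 2) (Fin 2) ℚ_[p] := !![0, 1; 1, (a : ℚ_[p])]

theorem matA_mulVecLin_injective (a : ℕ) : Function.Injective (matA p a).mulVecLin := by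
  intro u v h
  have h0 := congrFun h 0
  have h1 := congrFun h 1
  simp only [matA, Matrix.mulVecLin_apply, Matrix.mulVec, dotProduct, Fin.sum_univ_two,
    Matrix.of_apply, Matrix.cons_val_zero, Matrix.cons_val_one, Matrix.cons_val', zero_mul,
    one_mul, zero_add, Matrix.cons_val_fin_one] at h0 h1
  rw [h0] at h1
  funext i
  fin_cases i
  · exact add_right_cancel h1
  · exact h0

/-- The action `q ↦ A_a q` on the projective line. -/
noncomputable def actA (a : ℕ) : PLine p → PLine p :=
  Projectivization.map (matA p a).mulVecLin (matA_mulVecLin_injective p a)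

/-- The extended shift `T (w, q) = (T w, A_{a₁} q)`, where `a₁` is the first letter of `w`. -/
noncomputable def extShift (x : (ℕ → ℕ) × PLine p) : (ℕ → ℕ) × PLine p :=
  (shift x.1, actA p (x.1 0) x.2)

/-- The inequality defining badly approximable points, for a vector `v = (q₁, q₂)`:
for all integers `(a, b) ≠ (0, 0)`,
`|a q₁ + b q₂|_p * min (|q₁|_p⁻¹, |q₂|_p⁻¹) ≥ min (|a|⁻², |b|⁻²) * ε`.
The inverse of `0` is to be read as `∞` here, so that the two minima are
`(max (|q₁|_p, |q₂|_p))⁻¹` and `(max (|a|, |b|))⁻²`. -/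
def BadVec (ε : ℝ) (v : Fin 2 → ℚ_[p]) : Prop :=
  ∀ a b : ℤ, (a, b) ≠ (0, 0) →
    ‖(a : ℚ_[p]) * v 0 + (b : ℚ_[p]) * v 1‖ * (max ‖v 0‖ ‖v 1‖)⁻¹ ≥
      ((max |(a : ℝ)| |(b : ℝ)|) ^ 2)⁻¹ * ε

/-- The set `PBad_ε` of `p`-adically badly approximable points with constant `ε`. The condition
does not depend on the choice of homogeneous coordinates, see `mk_mem_PBad_iff`. -/
def PBad (ε : ℝ) : Set (PLine p) := {q | BadVec p ε q.rep}

theorem badVec_smul_iff (ε : ℝ) (c : ℚ_[p]) (hc : c ≠ 0) (v : Fin 2 → ℚ_[p]) :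
    BadVec p ε (c • v) ↔ BadVec p ε v := by
  have hc' : ‖c‖ ≠ 0 := norm_ne_zero_iff.mpr hc
  have key : ∀ a b : ℤ,
      ‖(a : ℚ_[p]) * (c • v) 0 + (b : ℚ_[p]) * (c • v) 1‖ *
          (max ‖(c • v) 0‖ ‖(c • v) 1‖)⁻¹ =
        ‖(a : ℚ_[p]) * v 0 + (b : ℚ_[p]) * v 1‖ * (max ‖v 0‖ ‖v 1‖)⁻¹ := by
    intro a b
    have e1 : (a : ℚ_[p]) * (c • v) 0 + (b : ℚ_[p]) * (c • v) 1
        = c * ((a : ℚ_[p]) * v 0 + (b : ℚ_[p]) * v 1) := by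
      simp only [Pi.smul_apply, smul_eq_mul]; ring
    rw [e1]
    simp only [Pi.smul_apply, smul_eq_mul, norm_mul]
    rw [← mul_max_of_nonneg _ _ (norm_nonneg c), mul_inv, mul_mul_mul_comm,
      mul_inv_cancel₀ hc', one_mul]
  simp only [BadVec, key]

theorem mk_mem_PBad_iff (ε : ℝ) (v : Fin 2 → ℚ_[p]) (hv : v ≠ 0) :
    Projectivization.mk ℚ_[p] v hv ∈ PBad p ε ↔ BadVec p ε v := by
  obtain ⟨c, hc⟩ := Projectivization.exists_smul_eq_mk_rep ℚ_[p] v hv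
  change BadVec p ε _ ↔ _
  rw [← hc]
  exact badVec_smul_iff p ε c c.ne_zero v

/-- The set `LMad_ε` of pairs `(w, x_p)` such that `T^n (w, x_p) ∈ {1, …, N}^ℕ × PBad_ε` for
every `n`, where `N = [ε⁻¹] + 1`. -/
def LMadEps (ε : ℝ) : Set ((ℕ → ℕ) × PLine p) :=
  {x | ∀ n : ℕ, (extShift p)^[n] x ∈ wordsOver (⌊ε⁻¹⌋₊ + 1) ×ˢ PBad p ε}

/-- The set `LMad`, the union of the sets `LMad_ε` over `ε > 0`. -/
def LMad : Set ((ℕ → ℕ) × PLine p) := {x | ∃ ε : ℝ, 0 < ε ∧ x ∈ LMadEps p ε}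

end Padic

end LimitWords

/-! Suppose that `x` stays in `PBad` along the word. Lift `x` to a unimodular vector and let `u i`
in `ℤ_p²` be its image under the matrix of the first `i` letters. Bad approximability then says that
every nonzero integral linear form `r` is bounded away from `0` on all the `u i`; from this alone
`w` is shown to be periodic.

Reduce modulo `p ^ k` and attach to each position `i` the set `F k i` of residues of `u` at the
occurrences of a long block starting at `i`. Over a uniformly recurrent word the transfer maps carry
these sets bijectively onto each other (`exists_blockSet_stable`), so `F k` colours `G_n` constantly
on components (`card_le_of_injective_blockSet`). Hence `F k` takes at most `C` values, uniformly in
`k`, and infinitely many positions share the same `F k` for every `k`.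

For two such positions `i < j`, the matrix `M` of the block between them permutes each `F k i`, so
every `M ^ e (u i)` is congruent modulo `p ^ k` to some `u l`. Thus no integral form becomes
arbitrarily small on the vectors `M ^ e (u i)`. By a Hensel-type digit by digit choice of the
exponent, this forces `u i` to be an eigenvector of `M` (`cross_intAct_eq_zero`).

As no integral form vanishes at `u i`, integer matrices with this eigenvector commute
(`commute_of_cross_eq_zero`). Matrices of blocks determine the blocks, so consecutive blocks between
positions of the class commute as words (`agree_of_commute`). With arbitrarily long second blocks,
`w` is periodic from `i` on, hence periodic by recurrence. -/

open scoped Matrix Polynomial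

namespace LimitWords

/-! ### Blocks of an infinite word -/

/-- The blocks of length `n` of `w` at the positions `i` and `j` coincide. -/
def Agree (w : ℕ → ℕ) (n i j : ℕ) : Prop := ∀ t < n, w (i + t) = w (j + t)

theorem Agree.symm {w : ℕ → ℕ} {n i j : ℕ} (h : Agree w n i j) : Agree w n j i :=
  fun t ht => (h t ht).symm

theorem Agree.trans {w : ℕ → ℕ} {n i j k : ℕ} (h : Agree w n i j) (h' : Agree w n j k) :
    Agree w n i k :=
  fun t ht => (h t ht).trans (h' t ht)

theorem Agree.mono {w : ℕ → ℕ} {m n i j : ℕ} (h : Agree w n i j) (hmn : m ≤ n) : Agree w m i j :=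
  fun t ht => h t (ht.trans_le hmn)

theorem Agree.drop {w : ℕ → ℕ} {m n i j : ℕ} (h : Agree w (m + n) i j) :
    Agree w n (i + m) (j + m) := by
  intro t ht
  simpa only [add_assoc] using h (m + t) (by omega)

/-- The block of length `n` of `w` at the position `i`. -/
def block (w : ℕ → ℕ) (n i : ℕ) : List ℕ := List.ofFn fun t : Fin n => w (i + t)

theorem occursAt_block_iff (w : ℕ → ℕ) (n i j : ℕ) :
    OccursAt w (block w n i) j ↔ Agree w n i j := by
  constructor
  · intro h t ht
    simpa [block] using (h t (by simpa [block] using ht)).symm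
  · intro h t ht
    simpa [block] using (h t (by simpa [block] using ht)).symm

theorem occursAt_iff_agree {w : ℕ → ℕ} {u : List ℕ} {i : ℕ} (hi : OccursAt w u i) (j : ℕ) :
    OccursAt w u j ↔ Agree w u.length i j :=
  ⟨fun hj t ht => (hi t ht).trans (hj t ht).symm, fun h t ht => (h t ht).symm.trans (hi t ht)⟩

theorem block_mem_factors (w : ℕ → ℕ) (n i : ℕ) : block w n i ∈ factors w n :=
  ⟨by simp [block], i, (occursAt_block_iff w n i i).2 fun _ _ => rfl⟩

theorem OccursAt.of_append_left {w : ℕ → ℕ} {s t : List ℕ} {i : ℕ} (h : OccursAt w (s ++ t) i) :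
    OccursAt w s i := by
  intro j hj
  rw [h j (by simp; omega), List.getElem_append_left hj]

theorem OccursAt.of_append_right {w : ℕ → ℕ} {s t : List ℕ} {i : ℕ} (h : OccursAt w (s ++ t) i) :
    OccursAt w t (i + s.length) := by
  intro j hj
  rw [add_assoc, h (s.length + j) (by simp; omega), List.getElem_append_right (by omega)]
  simp

/-- In a uniformly recurrent word the occurrences of a block are syndetic. -/
theorem IsUniformlyRecurrent.syndetic {w : ℕ → ℕ} (h : IsUniformlyRecurrent w) (n i : ℕ) :
    ∃ D, ∀ a, ∃ m ≤ D, Agree w n i (a + m) := by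
  classical
  have hfac := (block_mem_factors w n i).2
  obtain ⟨d, hd⟩ := h.2 _ hfac
  have hinf := h.1 _ hfac
  -- For `a ≤ i` the occurrence at `i` itself serves, at distance at most `i`. Beyond `i`, the
  -- occurrences surrounding `a` are consecutive, so the next one is within `d`.
  refine ⟨d + i, fun a => ?_⟩
  simp only [occursAt_block_iff] at hd hinf
  by_cases hai : a ≤ i
  · exact ⟨i - a, by omega, by rw [Nat.add_sub_cancel' hai]; exact fun _ _ => rfl⟩
  have hnext : ∃ b, a < b ∧ Agree w n i b := by
    obtain ⟨b, hb, hab⟩ := hinf.exists_gt a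
    exact ⟨b, hab, hb⟩
  have hprev : Agree w n i (Nat.findGreatest (fun b => Agree w n i b) a) :=
    Nat.findGreatest_spec (P := fun b => Agree w n i b) (m := i) (by omega) fun _ _ => rfl
  have hle := Nat.findGreatest_le (P := fun b => Agree w n i b) a
  have hspec := Nat.find_spec hnext
  have hgap := hd _ (Nat.find hnext) (by omega) hprev hspec.2 fun k hk hk' hk'' => by
    by_cases hka : k ≤ a
    · exact absurd (Nat.le_findGreatest (P := fun b => Agree w n i b) hka hk'') (by omega)
    · exact Nat.find_min hnext hk' ⟨by omega, hk''⟩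
  exact ⟨Nat.find hnext - a, by omega, by
    rw [Nat.add_sub_cancel' (by omega)]; exact hspec.2⟩

/-- A recurrent word that is periodic from some position on is periodic. -/
theorem IsRecurrent.isPeriodic {w : ℕ → ℕ} (h : IsRecurrent w) {i l : ℕ} (hl : 0 < l)
    (hper : ∀ t, w (i + t) = w (i + l + t)) : IsPeriodic w := by
  refine ⟨l, hl, fun a => ?_⟩
  -- Length `l + 1` covers both `a` and `a + l`; the block recurs beyond `i`, where the period is
  -- known.
  obtain ⟨b, hb, hib⟩ := (h _ (block_mem_factors w (l + 1) a).2).exists_gt i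
  have hag := (occursAt_block_iff w (l + 1) a b).1 hb
  have h0 := hag 0 (by omega)
  have h1 := hag l (by omega)
  have h2 := hper (b - i)
  rw [show i + (b - i) = b by omega, show i + l + (b - i) = b + l by omega] at h2
  simp only [add_zero] at h0
  rw [h0, h1, h2]

/-! ### Finite extensions of a uniformly recurrent word -/

section Extension

variable {Z : Type*} (w : ℕ → ℕ) (z : ℕ → Z)

/-- The values of `z` at the occurrences of the block of length `n` of `w` at the position `i`. -/
def blockSet (n i : ℕ) : Set Z := z '' {j | Agree w n i j}

variable {w z}

theorem mem_blockSet_self (n i : ℕ) : z i ∈ blockSet w z n i := ⟨i, fun _ _ => rfl, rfl⟩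

theorem blockSet_anti {m n : ℕ} (hmn : m ≤ n) (i : ℕ) : blockSet w z n i ⊆ blockSet w z m i :=
  Set.image_mono fun _ hj => Agree.mono hj hmn

theorem blockSet_congr {n i j : ℕ} (h : Agree w n i j) : blockSet w z n i = blockSet w z n j := by
  unfold blockSet
  congr 1
  ext k
  exact ⟨h.symm.trans, h.trans⟩

/-- Occurrences of a block, moved on by `m`, are occurrences of its suffix; the first `m` letters,
common to all of them, determine the transfer map. -/
theorem image_blockSet_subset {T : ℕ → ℕ → Z → Z}
    (hT : ∀ i j m, Agree w m i j → T i m (z j) = z (j + m)) (m n i : ℕ) :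
    T i m '' blockSet w z (m + n) i ⊆ blockSet w z n (i + m) := by
  rintro _ ⟨_, ⟨j, hj, rfl⟩, rfl⟩
  rw [hT i j m (Agree.mono hj (by omega))]
  exact ⟨j + m, Agree.drop hj, rfl⟩

/-- Let `z` be driven over a uniformly recurrent word `w` by injective transfer maps of a finite
set, the map from `i` to `i + m` depending only on the block of `w` between these positions. Then
the set of values of `z` over a long block depends only on a prefix of bounded length, and the
transfer maps permute these sets. -/
theorem exists_blockSet_stable [Finite Z] {T : ℕ → ℕ → Z → Z}
    (hT : ∀ i j m, Agree w m i j → T i m (z j) = z (j + m))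
    (hinj : ∀ i m, Function.Injective (T i m)) (hw : IsUniformlyRecurrent w) :
    ∃ n₀, ∀ n ≥ n₀, ∀ i, blockSet w z n i = blockSet w z n₀ i ∧
      ∀ m, T i m '' blockSet w z n₀ i = blockSet w z n₀ (i + m) := by
  obtain ⟨⟨n₁, i₁⟩, hmin⟩ : ∃ a : ℕ × ℕ, ∀ b : ℕ × ℕ,
      (blockSet w z a.1 a.2).ncard ≤ (blockSet w z b.1 b.2).ncard :=
    ⟨Function.argmin (fun a : ℕ × ℕ => (blockSet w z a.1 a.2).ncard),
      fun b => Function.argmin_le (fun a : ℕ × ℕ => (blockSet w z a.1 a.2).ncard) b⟩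
  obtain ⟨D, hD⟩ := hw.syndetic n₁ i₁
  -- A block of length at least `D + n₁` contains the block of minimal cardinality, and an injective
  -- transfer map sends its set of values into the minimal one.
  have hcard : ∀ n ≥ D + n₁, ∀ i, (blockSet w z n i).ncard = (blockSet w z n₁ i₁).ncard := by
    intro n hn i
    refine le_antisymm ?_ (hmin (n, i))
    obtain ⟨m, hm, hag⟩ := hD i
    rw [← Set.ncard_image_of_injective _ (hinj i m), blockSet_congr hag]
    refine Set.ncard_le_ncard ((Set.image_mono (blockSet_anti ?_ i)).trans
      (image_blockSet_subset hT m n₁ i)) (Set.toFinite _)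
    omega
  have hstab : ∀ n ≥ D + n₁, ∀ i, blockSet w z n i = blockSet w z (D + n₁) i := fun n hn i =>
    Set.eq_of_subset_of_ncard_le (blockSet_anti hn i)
      (by rw [hcard n hn i, hcard _ le_rfl i]) (Set.toFinite _)
  refine ⟨D + n₁, fun n hn i => ⟨hstab n hn i, fun m => ?_⟩⟩
  refine Set.eq_of_subset_of_ncard_le ?_ ?_ (Set.toFinite _)
  -- Lengthening the block by `m` does not change its set and pays for the `m` letters lost in the
  -- transfer.
  · rw [← hstab (m + (D + n₁)) (by omega) i]
    exact image_blockSet_subset hT m _ i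
  · rw [Set.ncard_image_of_injective _ (hinj i m), hcard _ le_rfl, hcard _ le_rfl]

/-- The number of sets of values of `z` over long blocks is at most the number of connected
components of the graph `G_n`. -/
theorem card_le_of_injective_blockSet [Finite Z] {T : ℕ → ℕ → Z → Z}
    (hT : ∀ i j m, Agree w m i j → T i m (z j) = z (j + m)) {n : ℕ}
    (hstab : ∀ i m, T i m '' blockSet w z n i = blockSet w z n (i + m)) {ι : Type*} (f : ι → ℕ)
    (hf : Function.Injective fun a => blockSet w z n (f a)) :
    ENat.card ι ≤ ENat.card (factorGraph w n).ConnectedComponent := by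
  -- A vertex of the second class is coloured by the values at the start of the block, one of the
  -- first class by those at its end. Along an edge both are the values at the junction of `s` and
  -- `t`.
  let color : factors w n ⊕ factors w n → Set Z :=
    Sum.elim (fun s => (fun j => z (j + n)) '' {j | OccursAt w s.1 j})
      (fun t => z '' {j | OccursAt w t.1 j})
  have hadj : ∀ s t : factors w n, IsFactor w (s.1 ++ t.1) →
      color (Sum.inl s) = color (Sum.inr t) := by
    rintro ⟨s, hs, hs'⟩ ⟨t, ht, ht'⟩ ⟨i, hi⟩
    have h1 : OccursAt w s i := OccursAt.of_append_left (t := t) hi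
    have h2 : OccursAt w t (i + s.length) := OccursAt.of_append_right hi
    rw [hs] at h2
    have e1 : color (Sum.inr ⟨t, ht, ht'⟩) = blockSet w z n (i + n) := by
      simp only [color, Sum.elim_inr, occursAt_iff_agree h2, ht, blockSet]
    have e2 : color (Sum.inl ⟨s, hs, hs'⟩) = T i n '' blockSet w z n i := by
      simp only [color, Sum.elim_inl, occursAt_iff_agree h1, hs, blockSet, Set.image_image]
      exact Set.image_congr fun j hj => (hT i j n hj).symm
    exact e2.trans ((hstab i n).trans e1.symm)
  have hreach : ∀ x y, (factorGraph w n).Reachable x y → color x = color y := by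
    rintro x y ⟨q⟩
    induction q with
    | nil => rfl
    | cons h _ ih =>
      refine Eq.trans ?_ ih
      rcases h with ⟨s, t, rfl, rfl, h⟩ | ⟨s, t, rfl, rfl, h⟩
      · exact hadj s t h
      · exact (hadj s t h).symm
  refine ENat.card_le_card_of_injective (f := fun a => (factorGraph w n).connectedComponentMk
    (Sum.inr ⟨block w n (f a), block_mem_factors w n (f a)⟩)) fun a b hab => hf ?_
  have := hreach _ _ (SimpleGraph.ConnectedComponent.exact hab)
  simp only [color, Sum.elim_inr, occursAt_block_iff] at this
  exact this

end Extension

/-! ### Matrices of blocks -/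

/-- The matrix `A_{w (i + n - 1)} ⋯ A_{w i}` of the block of length `n` at the position `i`. -/
def wordMat (w : ℕ → ℕ) (i : ℕ) : ℕ → Matrix (Fin 2) (Fin 2) ℤ
  | 0 => 1
  | n + 1 => !![0, 1; 1, (w (i + n) : ℤ)] * wordMat w i n

theorem wordMat_congr {w w' : ℕ → ℕ} {i j n : ℕ} (h : ∀ t < n, w (i + t) = w' (j + t)) :
    wordMat w i n = wordMat w' j n := by
  induction n with
  | zero => rfl
  | succ n ih => rw [wordMat, wordMat, ih fun t ht => h t (by omega), h n (by omega)]

theorem wordMat_add (w : ℕ → ℕ) (i m n : ℕ) :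
    wordMat w i (m + n) = wordMat w (i + m) n * wordMat w i m := by
  induction n with
  | zero => simp [wordMat]
  | succ n ih => rw [← add_assoc, wordMat, wordMat, ih, mul_assoc, add_assoc i m n]

theorem isUnit_det_wordMat (w : ℕ → ℕ) (i n : ℕ) : IsUnit (wordMat w i n).det := by
  induction n with
  | zero => simp [wordMat]
  | succ n ih =>
    rw [wordMat, Matrix.det_mul]
    exact IsUnit.mul (by simp [Matrix.det_fin_two_of]) ih

theorem wordMat_succ_row_zero (w : ℕ → ℕ) (i n : ℕ) (c : Fin 2) :
    wordMat w i (n + 1) 0 c = wordMat w i n 1 c := by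
  simp [wordMat, Matrix.mul_apply, Fin.sum_univ_two]

theorem wordMat_succ_row_one (w : ℕ → ℕ) (i n : ℕ) (c : Fin 2) :
    wordMat w i (n + 1) 1 c = wordMat w i n 0 c + w (i + n) * wordMat w i n 1 c := by
  simp [wordMat, Matrix.mul_apply, Fin.sum_univ_two]

/-- If `s` and `S` are the row sums, the next bottom row sum is `s + a * S` with `1 ≤ s ≤ S`. This
is a division with remainder, so it determines the new letter `a`. -/
theorem wordMat_row_sums {w : ℕ → ℕ} (hw : ∀ i, 1 ≤ w i) (i n : ℕ) :
    1 ≤ wordMat w i n 0 0 + wordMat w i n 0 1 ∧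
      wordMat w i n 0 0 + wordMat w i n 0 1 ≤ wordMat w i n 1 0 + wordMat w i n 1 1 := by
  induction n with
  | zero => simp [wordMat]
  | succ n ih =>
    simp only [wordMat_succ_row_zero, wordMat_succ_row_one]
    have : (1 : ℤ) ≤ w (i + n) := by exact_mod_cast hw (i + n)
    constructor <;> nlinarith

/-- The matrix of a block and its length determine the block. -/
theorem eq_of_wordMat_eq {w w' : ℕ → ℕ} (hw : ∀ i, 1 ≤ w i) (hw' : ∀ i, 1 ≤ w' i) {i j n : ℕ}
    (h : wordMat w i n = wordMat w' j n) : ∀ t < n, w (i + t) = w' (j + t) := by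
  induction n with
  | zero => intro t ht; omega
  | succ n ih =>
    have h0 : ∀ c, wordMat w i n 1 c = wordMat w' j n 1 c := fun c => by
      rw [← wordMat_succ_row_zero, h, wordMat_succ_row_zero]
    have h1 : ∀ c, wordMat w i n 0 c + w (i + n) * wordMat w i n 1 c =
        wordMat w' j n 0 c + w' (j + n) * wordMat w i n 1 c := fun c => by
      rw [← wordMat_succ_row_one, h, wordMat_succ_row_one, h0]
    have hs := wordMat_row_sums hw i n
    have hs' := wordMat_row_sums hw' j n
    rw [← h0, ← h0] at hs'
    have hsum : (wordMat w i n 0 0 + wordMat w i n 0 1) +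
          w (i + n) * (wordMat w i n 1 0 + wordMat w i n 1 1) =
        (wordMat w' j n 0 0 + wordMat w' j n 0 1) +
          w' (j + n) * (wordMat w i n 1 0 + wordMat w i n 1 1) := by
      linear_combination h1 0 + h1 1
    have hlast : (w (i + n) : ℤ) = w' (j + n) := by
      rcases lt_trichotomy (w (i + n) : ℤ) (w' (j + n)) with hlt | heq | hlt
      · nlinarith
      · exact heq
      · nlinarith
    have hmat : wordMat w i n = wordMat w' j n := by
      ext r c
      fin_cases r
      · have := h1 c
        rw [hlast] at this
        exact add_right_cancel this
      · exact h0 c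
    intro t ht
    rcases Nat.lt_succ_iff_lt_or_eq.1 ht with ht | rfl
    · exact ih hmat t ht
    · exact_mod_cast hlast

/-- If the matrices of two consecutive blocks commute then so do the blocks. -/
theorem agree_of_commute {w : ℕ → ℕ} (hw : ∀ i, 1 ≤ w i) {i m n : ℕ}
    (h : Commute (wordMat w i m) (wordMat w (i + m) n)) : Agree w n i (i + m) := by
  -- The two blocks concatenated in the opposite order; this need not be a factor of `w`.
  let w' : ℕ → ℕ := fun t => if t < n then w (i + m + t) else w (i + (t - n))
  have hw' : ∀ t, 1 ≤ w' t := fun t => by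
    by_cases ht : t < n <;> simp [w', ht, hw]
  have h1 : wordMat w' 0 n = wordMat w (i + m) n :=
    wordMat_congr fun t ht => by simp [w', ht]
  have h2 : wordMat w' (0 + n) m = wordMat w i m :=
    wordMat_congr fun t _ => by simp [w']
  have key : wordMat w i (n + m) = wordMat w' 0 (n + m) := by
    rw [wordMat_add w' 0 n m, h1, h2, add_comm n m, wordMat_add, h.eq]
  intro t ht
  rw [eq_of_wordMat_eq hw hw' key t (by omega)]
  simp [w', ht]

/-- Nonnegative integer matrices whose entries off the upper left corner are positive. -/
def HasPosEntries (M : Matrix (Fin 2) (Fin 2) ℤ) : Prop :=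
  0 ≤ M 0 0 ∧ 1 ≤ M 0 1 ∧ 1 ≤ M 1 0 ∧ 1 ≤ M 1 1

theorem HasPosEntries.mul {M M' : Matrix (Fin 2) (Fin 2) ℤ} (h : HasPosEntries M)
    (h' : HasPosEntries M') : HasPosEntries (M * M') := by
  obtain ⟨a, b, c, d⟩ := h
  obtain ⟨a', b', c', d'⟩ := h'
  simp only [HasPosEntries, Matrix.mul_apply, Fin.sum_univ_two]
  refine ⟨?_, ?_, ?_, ?_⟩ <;> nlinarith [mul_nonneg a a', mul_nonneg a (zero_le_one.trans b')]

theorem HasPosEntries.pow {M : Matrix (Fin 2) (Fin 2) ℤ} (h : HasPosEntries M) {m : ℕ}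
    (hm : m ≠ 0) : HasPosEntries (M ^ m) := by
  induction m with
  | zero => exact absurd rfl hm
  | succ m ih =>
    rcases eq_or_ne m 0 with rfl | hm'
    · simpa using h
    · rw [pow_succ]
      exact (ih hm').mul h

theorem hasPosEntries_wordMat {w : ℕ → ℕ} (hw : ∀ i, 1 ≤ w i) (i : ℕ) {n : ℕ} (hn : n ≠ 0) :
    HasPosEntries (wordMat w i n) := by
  have hw' : ∀ j, (1 : ℤ) ≤ w j := fun j => by exact_mod_cast hw j
  induction n with
  | zero => exact absurd rfl hn
  | succ n ih =>
    have hA : HasPosEntries !![0, 1; 1, (w (i + n) : ℤ)] := by simp [HasPosEntries, hw']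
    rcases eq_or_ne n 0 with rfl | hn'
    · simpa [wordMat] using hA
    · exact hA.mul (ih hn')

/-! ### Powers of an integer matrix acting on a `p`-adic vector -/

section Powers

variable {p : ℕ} [Fact p.Prime]

/-- The square on `p` makes the quadratic error in the `p`-th power divisible by `p ^ (h + 4)`,
including when `p = 2`. -/
theorem exists_one_add_sq_mul_pow {R : Type*} [CommRing R] (p : ℕ) (x : R) (h : ℕ) :
    ∃ q, (1 + (p : R) ^ 2 * x) ^ p ^ h = 1 + (p : R) ^ (h + 2) * (x * (1 + p * q)) := by
  induction h with
  | zero => exact ⟨0, by simp⟩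
  | succ h ih =>
    obtain ⟨q, hq⟩ := ih
    obtain ⟨k, hk⟩ := Polynomial.powAddExpansion (1 : R)
      ((p : R) ^ (h + 2) * (x * (1 + p * q))) p
    refine ⟨q + p ^ h * (x * (1 + p * q) ^ 2 * k), ?_⟩
    rw [pow_succ p h, pow_mul, hq, hk]
    simp only [one_pow]
    ring

theorem exists_one_add_sq_mul_pow_eq {R : Type*} [CommRing R] (p : ℕ) (x : R) (l : ℕ) :
    ∃ q, (1 + (p : R) ^ 2 * x) ^ l = 1 + p * q := by
  obtain ⟨k, hk⟩ := Polynomial.powAddExpansion (1 : R) ((p : R) ^ 2 * x) l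
  refine ⟨l * (p * x) + k * (p ^ 3 * x ^ 2), ?_⟩
  rw [hk]
  simp only [one_pow]
  ring

/-- An additive functional that is small at `1` takes arbitrarily small values at the powers of
`1 + p ^ 2 * x`, provided that its value at `x` divides all of its values. -/
theorem exists_dvd_apply_pow {R : Type*} [CommRing R] (L : R →+ ℤ_[p]) (x : R)
    (hL : ∀ y, L x ∣ L y) (h1 : (p : ℤ_[p]) ^ 2 * L x ∣ L 1) (h : ℕ) :
    ∃ l, (p : ℤ_[p]) ^ (h + 2) * L x ∣ L ((1 + (p : R) ^ 2 * x) ^ l) := by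
  have hmul : ∀ (k : ℕ) (y : R), L ((p : R) ^ k * y) = (p : ℤ_[p]) ^ k * L y := fun k y => by
    have := map_nsmul L (p ^ k) y
    simpa only [nsmul_eq_mul, Nat.cast_pow] using this
  induction h with
  | zero => exact ⟨0, by simpa using h1⟩
  | succ h ih =>
    obtain ⟨l, c, hc⟩ := ih
    obtain ⟨q, hq⟩ := exists_one_add_sq_mul_pow p x h
    -- Adding `p ^ h` to the exponent adds `p ^ (h + 2) * L x` to the value, up to a relative error
    -- divisible by `p`.
    have step : ∀ j : ℕ, ∃ e, L ((1 + (p : R) ^ 2 * x) ^ (l + j * p ^ h)) =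
        (p : ℤ_[p]) ^ (h + 2) * L x * (c + j + p * e) := by
      intro j
      induction j with
      | zero => exact ⟨0, by simpa using hc⟩
      | succ j ihj =>
        obtain ⟨e, he⟩ := ihj
        obtain ⟨y, hy⟩ := exists_one_add_sq_mul_pow_eq p x (l + j * p ^ h)
        obtain ⟨e', he'⟩ := hL (x * (q + y + p * q * y))
        refine ⟨e + e', ?_⟩
        have hsplit : (1 + (p : R) ^ 2 * x) ^ (l + (j + 1) * p ^ h) =
            (1 + (p : R) ^ 2 * x) ^ (l + j * p ^ h) + ((p : R) ^ (h + 2) * x +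
              (p : R) ^ (h + 3) * (x * (q + y + p * q * y))) := by
          rw [add_mul, one_mul, ← add_assoc, pow_add _ (l + j * p ^ h), hq, hy]
          ring
        rw [hsplit, map_add, map_add, hmul, hmul, he, he']
        push_cast
        ring
    -- The next `p`-adic digit of the exponent: `j` cancels `c` modulo `p`.
    obtain ⟨j, -, hj⟩ := PadicInt.exists_mem_range (-c)
    rw [PadicInt.maximalIdeal_eq_span_p, Ideal.mem_span_singleton] at hj
    obtain ⟨b, hb⟩ := hj
    obtain ⟨e, he⟩ := step j
    refine ⟨l + j * p ^ h, e - b, ?_⟩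
    rw [he]
    linear_combination (-(p : ℤ_[p]) ^ (h + 2) * L x) * hb

/-- The action of integer matrices on vectors over a ring. -/
def intAct {R : Type*} [CommRing R] (M : Matrix (Fin 2) (Fin 2) ℤ) (v : Fin 2 → R) : Fin 2 → R :=
  (Int.castRingHom R).mapMatrix M *ᵥ v

section intAct

variable {R : Type*} [CommRing R]

theorem intAct_apply (M : Matrix (Fin 2) (Fin 2) ℤ) (v : Fin 2 → R) (i : Fin 2) :
    intAct M v i = M i 0 * v 0 + M i 1 * v 1 := by
  simp [intAct, Matrix.mulVec, dotProduct, Fin.sum_univ_two]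

theorem intAct_one (v : Fin 2 → R) : intAct 1 v = v := by
  simp only [intAct, map_one, Matrix.one_mulVec]

theorem intAct_mul (M M' : Matrix (Fin 2) (Fin 2) ℤ) (v : Fin 2 → R) :
    intAct (M * M') v = intAct M (intAct M' v) := by
  simp only [intAct, map_mul, Matrix.mulVec_mulVec]

theorem intAct_smul (M : Matrix (Fin 2) (Fin 2) ℤ) (c : R) (v : Fin 2 → R) :
    intAct M (c • v) = c • intAct M v := by
  simp only [intAct, Matrix.mulVec_smul]

theorem intAct_injective {M : Matrix (Fin 2) (Fin 2) ℤ} (hM : IsUnit M.det) :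
    Function.Injective (intAct M : (Fin 2 → R) → Fin 2 → R) := by
  refine Function.LeftInverse.injective (g := intAct M⁻¹) fun v => ?_
  rw [← intAct_mul, Matrix.nonsing_inv_mul _ hM, intAct_one]

theorem map_intAct {S : Type*} [CommRing S] (f : R →+* S) (M : Matrix (Fin 2) (Fin 2) ℤ)
    (v : Fin 2 → R) : (fun i => f (intAct M v i)) = intAct M fun i => f (v i) := by
  funext i
  simp [intAct_apply]

end intAct

/-- The value at `v` of the linear form with integer coefficients `r`. -/
noncomputable def intForm (r : Fin 2 → ℤ) (v : Fin 2 → ℤ_[p]) : ℤ_[p] := r 0 * v 0 + r 1 * v 1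

/-- The determinant of the matrix with columns `v` and `u`. -/
noncomputable def cross (v u : Fin 2 → ℤ_[p]) : ℤ_[p] := v 0 * u 1 - v 1 * u 0

theorem one_add_sq_mul_apply (p : ℕ) (Y : Matrix (Fin 2) (Fin 2) ℤ) (i j : Fin 2) :
    (1 + (p : Matrix (Fin 2) (Fin 2) ℤ) ^ 2 * Y : Matrix (Fin 2) (Fin 2) ℤ) i j =
      (if i = j then 1 else 0) + (p : ℤ) ^ 2 * Y i j := by
  have h : (p : Matrix (Fin 2) (Fin 2) ℤ) ^ 2 * Y = ((p : ℤ) ^ 2) • Y := by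
    rw [← Int.cast_natCast, ← Int.cast_pow, zsmul_eq_mul]
  rw [h, Matrix.add_apply, Matrix.one_apply, Matrix.smul_apply, smul_eq_mul]

/-- By Cayley–Hamilton, only the remainder `α + β X` of `P` modulo the characteristic polynomial
matters. -/
theorem exists_aeval_apply_eq (Y : Matrix (Fin 2) (Fin 2) ℤ) (P : ℤ[X]) :
    ∃ α β : ℤ, ∀ i j, Polynomial.aeval Y P i j = (if i = j then α else 0) + β * Y i j := by
  have hdeg : (P %ₘ Y.charpoly).degree ≤ 1 := by
    have := Polynomial.degree_modByMonic_lt P Y.charpoly_monic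
    rw [Matrix.charpoly_degree_eq_dim, Fintype.card_fin] at this
    exact Order.le_of_lt_succ this
  refine ⟨(P %ₘ Y.charpoly).coeff 0, (P %ₘ Y.charpoly).coeff 1, fun i j => ?_⟩
  rw [Matrix.aeval_eq_aeval_mod_charpoly]
  nth_rw 1 [Polynomial.eq_X_add_C_of_degree_le_one hdeg]
  rw [map_add, map_mul, Polynomial.aeval_X, Polynomial.aeval_C, Polynomial.aeval_C,
    Algebra.algebraMap_eq_smul_one, Algebra.algebraMap_eq_smul_one, smul_mul_assoc, one_mul,
    Matrix.add_apply, Matrix.smul_apply, Matrix.smul_apply, Matrix.one_apply, add_comm]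
  simp

/-- If `v` is not an eigenvector of `Y` then there is an integral linear form whose values at the
vectors `(1 + p ^ 2 Y) ^ l v` are arbitrarily small. -/
theorem exists_intForm_dvd (Y : Matrix (Fin 2) (Fin 2) ℤ) (v : Fin 2 → ℤ_[p])
    (hY : cross v (intAct Y v) ≠ 0) :
    ∃ r : Fin 2 → ℤ, r ≠ 0 ∧ ∀ h : ℕ, ∃ l : ℕ,
      (p : ℤ_[p]) ^ h ∣ intForm r (intAct ((1 + (p : Matrix (Fin 2) (Fin 2) ℤ) ^ 2 * Y) ^ l) v) := by
  set c := (cross v (intAct Y v)).valuation with hc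
  have hD := PadicInt.unitCoeff_spec hY
  rw [← hc] at hD
  set u := PadicInt.unitCoeff hY
  have approx : ∀ a : ℤ_[p], ∃ (b : ℤ) (e : ℤ_[p]), (b : ℤ_[p]) = a + p ^ (c + 2) * e := by
    intro a
    obtain ⟨e, he⟩ := Ideal.mem_span_singleton.1 (PadicInt.appr_spec (c + 2) a)
    exact ⟨a.appr (c + 2), -e, by push_cast; linear_combination -he⟩
  -- The form with coefficients `(-v 1, v 0)` is `cross v`, which kills `v` and has valuation `c` at
  -- `Y v`. Integer coefficients correct modulo `p ^ (c + 2)` keep the valuation at `Y v` and leave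
  -- a value at `v` divisible by `p ^ (c + 2)`.
  obtain ⟨r₀, e₀, h₀⟩ := approx (-v 1)
  obtain ⟨r₁, e₁, h₁⟩ := approx (v 0)
  have hδ : intForm ![r₀, r₁] (intAct Y v) = p ^ c * (u + p * (p * (e₀ * intAct Y v 0 +
      e₁ * intAct Y v 1))) := by
    simp only [cross] at hD
    simp only [intForm, Matrix.cons_val_zero, Matrix.cons_val_one, h₀, h₁]
    linear_combination hD
  have hρ : intForm ![r₀, r₁] v = p ^ (c + 2) * (e₀ * v 0 + e₁ * v 1) := by
    simp only [intForm, Matrix.cons_val_zero, Matrix.cons_val_one, h₀, h₁]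
    ring
  have hunit : IsUnit ((u : ℤ_[p]) + p * (p * (e₀ * intAct Y v 0 + e₁ * intAct Y v 1))) := by
    by_contra hn
    have h1 : (p : ℤ_[p]) * (p * (e₀ * intAct Y v 0 + e₁ * intAct Y v 1)) ∈
        IsLocalRing.maximalIdeal ℤ_[p] := by
      rw [PadicInt.maximalIdeal_eq_span_p, Ideal.mem_span_singleton]
      exact dvd_mul_right _ _
    have h2 := ((IsLocalRing.maximalIdeal ℤ_[p]).add_mem_iff_left h1).1
      ((IsLocalRing.mem_maximalIdeal _).2 hn)
    exact (IsLocalRing.mem_maximalIdeal _).1 h2 u.isUnit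
  have hp0 : (p : ℤ_[p]) ≠ 0 := by exact_mod_cast (Fact.out : p.Prime).ne_zero
  have hdvd : intForm ![r₀, r₁] (intAct Y v) ∣ (p : ℤ_[p]) ^ c := by
    rw [hδ]
    exact hunit.mul_right_dvd.2 dvd_rfl
  have hdvd' : (p : ℤ_[p]) ^ 2 * intForm ![r₀, r₁] (intAct Y v) ∣ intForm ![r₀, r₁] v := by
    rw [hρ, pow_add, mul_comm ((p : ℤ_[p]) ^ c)]
    exact (mul_dvd_mul_left _ hdvd).mul_right _
  -- Polynomials in `Y` form a commutative setting in which the digit argument applies with `x = X`.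
  let L : Polynomial ℤ →+ ℤ_[p] :=
    { toFun := fun P => intForm ![r₀, r₁] (intAct (Polynomial.aeval Y P) v)
      map_zero' := by simp [intForm, intAct_apply]
      map_add' := fun P Q => by
        simp only [intForm, intAct_apply, map_add, Matrix.add_apply, Int.cast_add]
        ring }
  have hLX : L Polynomial.X = intForm ![r₀, r₁] (intAct Y v) := by simp [L]
  have hL1 : L 1 = intForm ![r₀, r₁] v := by simp [L, intAct_one]
  have hL : ∀ P, L Polynomial.X ∣ L P := by
    intro P
    obtain ⟨α, β, hP⟩ := exists_aeval_apply_eq Y P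
    have : L P = α * L 1 + β * L Polynomial.X := by
      rw [hL1, hLX]
      change intForm ![r₀, r₁] (intAct (Polynomial.aeval Y P) v) = _
      simp [intForm, intAct_apply, hP]
      ring
    rw [this]
    refine dvd_add (Dvd.dvd.mul_left ?_ _) (dvd_mul_left _ _)
    rw [hL1, hLX]
    exact (dvd_mul_left _ _).trans hdvd'
  refine ⟨![r₀, r₁], fun hr => ?_, fun h => ?_⟩
  · rw [hr] at hδ
    have : (p : ℤ_[p]) ^ c * (u + p * (p * (e₀ * intAct Y v 0 + e₁ * intAct Y v 1))) = 0 := by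
      rw [← hδ]; simp [intForm]
    rcases mul_eq_zero.1 this with h | h
    · exact pow_ne_zero _ hp0 h
    · exact hunit.ne_zero h
  · obtain ⟨l, hl⟩ := exists_dvd_apply_pow L Polynomial.X hL (by rwa [hLX, hL1]) h
    refine ⟨l, ?_⟩
    have : L ((1 + (p : Polynomial ℤ) ^ 2 * Polynomial.X) ^ l) = intForm ![r₀, r₁]
        (intAct ((1 + (p : Matrix (Fin 2) (Fin 2) ℤ) ^ 2 * Y) ^ l) v) := by simp [L]
    rw [← this]
    exact (((pow_dvd_pow _ (by omega)).mul_right _).trans hl)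

/-- The reduction of `M` modulo `p ^ 2` is a unit of a finite ring, hence of finite order. -/
theorem exists_pow_eq_one_add_sq_mul {M : Matrix (Fin 2) (Fin 2) ℤ} (hM : IsUnit M.det) :
    ∃ m ≠ 0, ∃ Y, M ^ m = 1 + (p : Matrix (Fin 2) (Fin 2) ℤ) ^ 2 * Y := by
  have hp : p ^ 2 ≠ 0 := pow_ne_zero _ (Fact.out : p.Prime).ne_zero
  have : NeZero (p ^ 2) := ⟨hp⟩
  let f := (Int.castRingHom (ZMod (p ^ 2))).mapMatrix (m := Fin 2)
  obtain ⟨U, hU⟩ := ((Matrix.isUnit_iff_isUnit_det M).2 hM).map f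
  obtain ⟨m, hm, hUm⟩ := (isOfFinOrder_of_finite U).exists_pow_eq_one
  have hf : f (M ^ m) = 1 := by
    rw [map_pow, ← hU, ← Units.val_pow_eq_pow_val, hUm, Units.val_one]
  have hdvd : ∀ i j, ((p ^ 2 : ℕ) : ℤ) ∣ (M ^ m - 1) i j := by
    intro i j
    have : f (M ^ m - 1) i j = 0 := by rw [map_sub, hf, map_one, sub_self]; rfl
    exact (ZMod.intCast_zmod_eq_zero_iff_dvd _ _).1 (by simpa [f] using this)
  choose Y hY using hdvd
  refine ⟨m, hm.ne', Matrix.of Y, ?_⟩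
  ext i j
  have := hY i j
  rw [Matrix.sub_apply, Matrix.one_apply] at this
  rw [one_add_sq_mul_apply, Matrix.of_apply, sub_eq_iff_eq_add'.1 this]
  push_cast
  rfl

/-- If no integral linear form is arbitrarily small at the vectors `M ^ e v` then `v` is an
eigenvector of `M`. -/
theorem cross_intAct_eq_zero {M : Matrix (Fin 2) (Fin 2) ℤ} (hM : IsUnit M.det)
    (hpos : HasPosEntries M) {v : Fin 2 → ℤ_[p]}
    (hbad : ∀ r : Fin 2 → ℤ, r ≠ 0 → ∃ h : ℕ, ∀ e : ℕ,
      ¬ (p : ℤ_[p]) ^ h ∣ intForm r (intAct (M ^ e) v)) :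
    cross v (intAct M v) = 0 := by
  obtain ⟨m, hm, Y, hY⟩ := exists_pow_eq_one_add_sq_mul (p := p) hM
  have hYv : cross v (intAct Y v) = 0 := by
    by_contra hne
    obtain ⟨r, hr, hsmall⟩ := exists_intForm_dvd Y v hne
    obtain ⟨h, hh⟩ := hbad r hr
    obtain ⟨l, hl⟩ := hsmall h
    rw [← hY, ← pow_mul] at hl
    exact hh _ hl
  have hYij : ∀ i j, (M ^ m) i j = (if i = j then 1 else 0) + (p : ℤ) ^ 2 * Y i j := fun i j => by
    rw [hY, one_add_sq_mul_apply]
  have hMm : cross v (intAct (M ^ m) v) = 0 := by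
    have : cross v (intAct (M ^ m) v) = p ^ 2 * cross v (intAct Y v) := by
      simp [cross, intAct_apply, hYij]
      ring
    rw [this, hYv, mul_zero]
  -- Since `M ^ m = α + β M`, an eigenvector of `M ^ m` is one of `M` unless `β = 0`, which is
  -- excluded by the positive off-diagonal entry of `M ^ m`.
  obtain ⟨α, β, hP⟩ := exists_aeval_apply_eq M (Polynomial.X ^ m)
  rw [map_pow, Polynomial.aeval_X] at hP
  have hβ : β ≠ 0 := by
    rintro rfl
    have := (hpos.pow hm).2.1
    simp [hP] at this
  have : cross v (intAct (M ^ m) v) = β * cross v (intAct M v) := by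
    simp [cross, intAct_apply, hP]
    ring
  rw [this] at hMm
  exact (mul_eq_zero.1 hMm).resolve_left (by exact_mod_cast hβ)

/-- Integer matrices with a common eigenvector that is not proportional to a rational one
commute. -/
theorem commute_of_cross_eq_zero {M M' : Matrix (Fin 2) (Fin 2) ℤ} {v : Fin 2 → ℤ_[p]}
    (hv : ∀ r : Fin 2 → ℤ, r ≠ 0 → intForm r v ≠ 0) (hM : cross v (intAct M v) = 0)
    (hM' : cross v (intAct M' v) = 0) : Commute M M' := by
  have hv0 : v 0 ≠ 0 := by
    have := hv ![1, 0] (fun h => by simpa using congrFun h 0)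
    simpa [intForm] using this
  have key : ∀ A : Matrix (Fin 2) (Fin 2) ℤ, cross v (intAct A v) = 0 →
      v 0 • intAct A v = intAct A v 0 • v := by
    intro A hA
    unfold cross at hA
    funext i
    fin_cases i
    · exact mul_comm _ _
    · simp only [Fin.mk_one, Pi.smul_apply, smul_eq_mul]
      linear_combination hA
  have hmul : ∀ A B : Matrix (Fin 2) (Fin 2) ℤ, cross v (intAct A v) = 0 →
      cross v (intAct B v) = 0 →
      (v 0 * v 0) • intAct (A * B) v = (intAct A v 0 * intAct B v 0) • v := by
    intro A B hA hB
    rw [intAct_mul, mul_smul, ← intAct_smul, key B hB, intAct_smul, smul_comm, key A hA,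
      smul_smul, mul_comm]
  have heq : intAct (M * M') v = intAct (M' * M) v := by
    have := (hmul M M' hM hM').trans ((mul_comm (intAct M v 0) _ ▸ hmul M' M hM' hM).symm)
    exact smul_right_injective _ (mul_ne_zero hv0 hv0) this
  ext i j
  -- Each row of the commutator is an integral form vanishing at `v`.
  have hrow : (fun j => (M * M') i j - (M' * M) i j) = 0 := by
    by_contra hne
    refine hv _ hne ?_
    have := congrFun heq i
    rw [intAct_apply, intAct_apply] at this
    simp only [intForm, Int.cast_sub]
    linear_combination this
  exact sub_eq_zero.1 (congrFun hrow j)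

end Powers

/-! ### Orbits of `p`-adic vectors along a word -/

section Orbit

variable {p : ℕ} [Fact p.Prime]

/-- Let a sequence of `p`-adic vectors be driven over a uniformly recurrent word `w` by the matrices
of the blocks of `w`. If the graphs `G_n` have boundedly many connected components and every
nonzero integral linear form is bounded away from zero on the sequence, then `w` is periodic. -/
theorem isPeriodic_of_intForm_bounded {w : ℕ → ℕ} (hw : ∀ i, 1 ≤ w i)
    (hrec : IsUniformlyRecurrent w) {C : ℕ}
    (hcomp : ∀ n : ℕ, ENat.card (factorGraph w n).ConnectedComponent ≤ (C : ℕ∞))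
    {u : ℕ → Fin 2 → ℤ_[p]} (hu : ∀ i m, u (i + m) = intAct (wordMat w i m) (u i))
    (hbad : ∀ r : Fin 2 → ℤ, r ≠ 0 → ∃ h : ℕ, ∀ i, ¬ (p : ℤ_[p]) ^ h ∣ intForm r (u i)) :
    IsPeriodic w := by
  have hp : ∀ k, NeZero (p ^ k) := fun k => ⟨pow_ne_zero _ (Fact.out : p.Prime).ne_zero⟩
  let z : ∀ k, ℕ → Fin 2 → ZMod (p ^ k) := fun k i c => PadicInt.toZModPow k (u i c)
  have hT : ∀ k i j m, Agree w m i j → intAct (wordMat w i m) (z k j) = z k (j + m) := by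
    intro k i j m hij
    rw [wordMat_congr hij]
    simp only [z, hu]
    exact (map_intAct _ _ _).symm
  choose n₀ hn₀ using fun k => exists_blockSet_stable (hT k)
    (fun i m => intAct_injective (isUnit_det_wordMat w i m)) hrec
  let F : ∀ k, ℕ → Set (Fin 2 → ZMod (p ^ k)) := fun k i => blockSet w (z k) (n₀ k) i
  have hmono : ∀ {k k' i j}, k ≤ k' → F k' i = F k' j → F k i = F k j := by
    intro k k' i j hk h
    let π : (Fin 2 → ZMod (p ^ k')) → Fin 2 → ZMod (p ^ k) :=
      fun y c => ZMod.castHom (pow_dvd_pow p hk) (ZMod (p ^ k)) (y c)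
    have hπ : ∀ i, π (z k' i) = z k i := by
      intro i
      funext c
      exact congrArg (fun f => f (u i c)) (PadicInt.zmod_cast_comp_toZModPow k k' hk)
    -- Both sets can be computed from blocks of a common length beyond the two stable lengths, so
    -- equality at a finer level implies equality at a coarser one.
    have himage : ∀ i, F k i = π '' F k' i := by
      intro i
      have e1 := (hn₀ k (max (n₀ k) (n₀ k')) (le_max_left _ _) i).1
      have e2 := (hn₀ k' (max (n₀ k) (n₀ k')) (le_max_right _ _) i).1
      simp only [F]
      rw [← e1, ← e2, blockSet, blockSet, Set.image_image]
      exact Set.image_congr fun j _ => (hπ j).symm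
    rw [himage, himage, h]
  let S : Setoid ℕ :=
    ⟨fun i j => ∀ k, F k i = F k j, fun _ _ => rfl, fun h k => (h k).symm,
      fun h h' k => (h k).trans (h' k)⟩
  have hfin : Finite (Quotient S) := by
    by_contra hinf
    rw [not_finite_iff_infinite] at hinf
    let g : Fin (C + 1) ↪ Quotient S :=
      (Fin.valEmbedding).trans (Infinite.natEmbedding (Quotient S))
    let f : Fin (C + 1) → ℕ := fun a => (g a).out
    have hf : ∀ a b, a ≠ b → ∃ k, F k (f a) ≠ F k (f b) := by
      intro a b hab
      by_contra! h
      refine hab (g.injective ?_)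
      rw [← Quotient.out_eq (g a), ← Quotient.out_eq (g b)]
      exact Quotient.sound h
    choose! κ hκ using hf
    -- A single level `K` separates all `C + 1` chosen classes, contradicting the bound `C` on the
    -- number of colours at that level.
    obtain ⟨K, hK⟩ := (Set.finite_range fun ab : Fin (C + 1) × Fin (C + 1) =>
      κ ab.1 ab.2).bddAbove
    have hinj : Function.Injective fun a => F K (f a) := by
      intro a b hab
      by_contra hne
      exact hκ a b hne (hmono (hK ⟨(a, b), rfl⟩) hab)
    have hle := (card_le_of_injective_blockSet (hT K)
      (fun i m => (hn₀ K _ le_rfl i).2 m) f hinj).trans (hcomp _)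
    rw [ENat.card_eq_coe_fintype_card, Fintype.card_fin, Nat.cast_le] at hle
    omega
  obtain ⟨q, hq⟩ := Finite.exists_infinite_fiber (fun i : ℕ => (Quotient.mk S i))
  have hq' : {i : ℕ | Quotient.mk S i = q}.Infinite := Set.infinite_coe_iff.1 hq
  have hclass : ∀ {i j}, Quotient.mk S i = q → Quotient.mk S j = q → ∀ k, F k i = F k j :=
    fun hi hj => Quotient.exact (hi.trans hj.symm)
  have heigen : ∀ {i j}, i < j → Quotient.mk S i = q → Quotient.mk S j = q →
      cross (u i) (intAct (wordMat w i (j - i)) (u i)) = 0 := by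
    intro i j hij hi hj
    refine cross_intAct_eq_zero (isUnit_det_wordMat w i _)
      (hasPosEntries_wordMat hw i (by omega)) fun r hr => ?_
    obtain ⟨h, hh⟩ := hbad r hr
    refine ⟨h, fun e hdvd => ?_⟩
    -- The matrix maps `F h i` onto `F h j`, which is `F h i` again.
    have hmem : ∀ e, (intAct (wordMat w i (j - i) ^ e) (z h i)) ∈ F h i := by
      intro e
      induction e with
      | zero =>
        rw [pow_zero, intAct_one]
        exact mem_blockSet_self _ _
      | succ e ih =>
        rw [pow_succ', intAct_mul]
        have := (hn₀ h _ le_rfl i).2 (j - i)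
        rw [Nat.add_sub_cancel' hij.le] at this
        rw [hclass hi hj h]
        exact this.subset (Set.mem_image_of_mem _ ih)
    obtain ⟨l, -, hl⟩ := hmem e
    refine hh l ?_
    rw [← Ideal.mem_span_singleton, ← PadicInt.ker_toZModPow, RingHom.mem_ker] at hdvd ⊢
    rw [← hdvd]
    have hl' : ∀ c, PadicInt.toZModPow h (u l c) =
        PadicInt.toZModPow h (intAct (wordMat w i (j - i) ^ e) (u i) c) := fun c => by
      refine (congrFun hl c).trans ?_
      exact (congrFun (map_intAct (PadicInt.toZModPow h) _ (u i)) c).symm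
    simp only [intForm, map_add, map_mul, hl']
  have hirr : ∀ i, ∀ r : Fin 2 → ℤ, r ≠ 0 → intForm r (u i) ≠ 0 := by
    intro i r hr h0
    obtain ⟨h, hh⟩ := hbad r hr
    exact hh i (h0 ▸ dvd_zero _)
  obtain ⟨i, hi⟩ := hq'.nonempty
  obtain ⟨j, hj, hij⟩ := hq'.exists_gt i
  refine hrec.1.isPeriodic (i := i) (l := j - i) (by omega) fun t => ?_
  -- The block from `j` to `k` must be long enough for the resulting agreement to reach offset `t`.
  obtain ⟨k, hk, hjk⟩ := hq'.exists_gt (j + t)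
  have h1 := heigen hij hi hj
  have h2 := heigen (by omega : i < k) hi hk
  have hcomm := commute_of_cross_eq_zero (hirr i) h1 h2
  have hsplit : wordMat w i (k - i) =
      wordMat w (i + (j - i)) (k - j) * wordMat w i (j - i) := by
    rw [← wordMat_add]
    congr 1
    omega
  have hcomm' : Commute (wordMat w i (j - i)) (wordMat w (i + (j - i)) (k - j)) := by
    -- The matrix from `i` to `j` commutes with its product with the matrix from `j` to `k`;
    -- cancelling it shows that the two factors commute.
    have hreg := (Matrix.isUnit_iff_isUnit_det _).2 (isUnit_det_wordMat w i (j - i))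
    refine hreg.mul_right_cancel ?_
    rw [hsplit] at hcomm
    simpa only [mul_assoc] using hcomm.eq
  exact agree_of_commute hw hcomm' t (by omega)

/-- A `p`-adic integral vector is unimodular if its coordinates are not both divisible by `p`. -/
def Unimodular (v : Fin 2 → ℤ_[p]) : Prop := ¬ ∀ i, (p : ℤ_[p]) ∣ v i

theorem Unimodular.intAct {v : Fin 2 → ℤ_[p]} (hv : Unimodular v)
    {M : Matrix (Fin 2) (Fin 2) ℤ} (hM : IsUnit M.det) : Unimodular (intAct M v) := by
  refine fun h => hv fun i => ?_
  have : v = LimitWords.intAct M⁻¹ (LimitWords.intAct M v) := by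
    rw [← intAct_mul, Matrix.nonsing_inv_mul _ hM, intAct_one]
  rw [this, intAct_apply]
  exact dvd_add ((h 0).mul_left _) ((h 1).mul_left _)

theorem Unimodular.max_norm {v : Fin 2 → ℤ_[p]} (hv : Unimodular v) :
    max ‖(v 0 : ℚ_[p])‖ ‖(v 1 : ℚ_[p])‖ = 1 := by
  refine le_antisymm (max_le (v 0).2 (v 1).2) ?_
  by_contra! h
  refine hv fun i => (PadicInt.norm_lt_one_iff_dvd _).1 ?_
  fin_cases i
  · exact (le_max_left _ _).trans_lt h
  · exact (le_max_right _ _).trans_lt h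

theorem Unimodular.coe_ne_zero {v : Fin 2 → ℤ_[p]} (hv : Unimodular v) :
    (fun i => (v i : ℚ_[p])) ≠ 0 := by
  intro h
  have h0 := congrFun h 0
  have h1 := congrFun h 1
  have := hv.max_norm
  simp only [Pi.zero_apply] at h0 h1
  simp [h0, h1] at this

/-- Every point of the projective line has unimodular homogeneous coordinates. -/
theorem exists_unimodular_mk_eq (x : PLine p) :
    ∃ (v : Fin 2 → ℤ_[p]) (hv : Unimodular v),
      x = Projectivization.mk ℚ_[p] (fun i => (v i : ℚ_[p])) hv.coe_ne_zero := by
  -- Dividing by a coordinate of maximal norm makes all coordinates integral and one of them equal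
  -- to `1`.
  obtain ⟨c, hc⟩ : ∃ c, ∀ i, ‖x.rep i‖ ≤ ‖x.rep c‖ := Finite.exists_max fun i => ‖x.rep i‖
  have hc0 : x.rep c ≠ 0 := by
    intro h0
    refine x.rep_nonzero (funext fun i => ?_)
    have := hc i
    rw [h0, norm_zero] at this
    exact norm_le_zero_iff.1 this
  let v : Fin 2 → ℤ_[p] := fun i => ⟨x.rep i / x.rep c, by
    rw [norm_div]
    exact div_le_one_of_le₀ (hc i) (norm_nonneg _)⟩
  have hv : Unimodular v := by
    intro h
    have h1 := (PadicInt.norm_lt_one_iff_dvd _).2 (h c)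
    have h2 : v c = 1 := Subtype.ext (div_self hc0)
    rw [h2, norm_one] at h1
    exact lt_irrefl _ h1
  refine ⟨v, hv, ?_⟩
  conv_lhs => rw [← x.mk_rep]
  rw [Projectivization.mk_eq_mk_iff']
  refine ⟨x.rep c, funext fun i => ?_⟩
  exact mul_div_cancel₀ _ hc0

theorem iterate_extShift (w : ℕ → ℕ) {v : Fin 2 → ℤ_[p]} (hv : Unimodular v) (n : ℕ) :
    (extShift p)^[n] (w, Projectivization.mk ℚ_[p] (fun i => (v i : ℚ_[p])) hv.coe_ne_zero) =
      (fun t => w (n + t), Projectivization.mk ℚ_[p]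
        (fun i => ((intAct (wordMat w 0 n) v i : ℤ_[p]) : ℚ_[p]))
        (hv.intAct (isUnit_det_wordMat w 0 n)).coe_ne_zero) := by
  induction n with
  | zero => simp [wordMat, intAct_one]
  | succ n ih =>
    rw [Function.iterate_succ_apply', ih, extShift, actA, Projectivization.map_mk]
    refine Prod.ext (funext fun t => ?_) ?_
    · simp only [shift]
      congr 1
      omega
    · simp only [add_zero]
      congr 1
      funext i
      rw [wordMat, intAct_mul, zero_add]
      fin_cases i <;> simp [matA, intAct_apply, Matrix.mulVec, dotProduct, Fin.sum_univ_two]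

/-- A nonzero integral linear form is bounded away from zero on the badly approximable
vectors. -/
theorem exists_not_dvd_intForm {ε : ℝ} (hε : 0 < ε) {r : Fin 2 → ℤ} (hr : r ≠ 0) :
    ∃ h : ℕ, ∀ v : Fin 2 → ℤ_[p], Unimodular v → BadVec p ε (fun i => (v i : ℚ_[p])) →
      ¬ (p : ℤ_[p]) ^ h ∣ intForm r v := by
  have hr' : (r 0, r 1) ≠ (0, 0) := by
    intro h
    rw [Prod.mk.injEq] at h
    exact hr (funext fun i => by fin_cases i; exacts [h.1, h.2])
  have hpos : 0 < ((max |(r 0 : ℝ)| |(r 1 : ℝ)|) ^ 2)⁻¹ * ε := by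
    refine mul_pos (inv_pos.2 (pow_pos ?_ 2)) hε
    by_contra! h
    refine hr' (Prod.ext ?_ ?_)
    · exact_mod_cast abs_nonpos_iff.1 ((le_max_left _ _).trans h)
    · exact_mod_cast abs_nonpos_iff.1 ((le_max_right _ _).trans h)
  have hp : (1 : ℝ) < p := by exact_mod_cast (Fact.out : p.Prime).one_lt
  -- Divisibility by `p ^ h` would push the norm to at most `p ^ (-h)`, below the bound from
  -- `BadVec`, whose maximum factor is `1` for unimodular vectors.
  obtain ⟨h, hh⟩ := exists_pow_lt_of_lt_one hpos (inv_lt_one_of_one_lt₀ hp)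
  refine ⟨h, fun v hv hbad hdvd => ?_⟩
  have h1 := hbad (r 0) (r 1) hr'
  rw [hv.max_norm, inv_one, mul_one] at h1
  have h2 := (PadicInt.norm_le_pow_iff_mem_span_pow _ h).2 (Ideal.mem_span_singleton.2 hdvd)
  rw [zpow_neg, zpow_natCast, ← inv_pow] at h2
  have h3 : ‖intForm r v‖ = ‖(r 0 : ℚ_[p]) * v 0 + (r 1 : ℚ_[p]) * v 1‖ := by
    rw [PadicInt.norm_def]
    simp [intForm]
  rw [h3] at h2
  linarith

end Orbit

end LimitWords

theorem theorem2p5 (p : ℕ) [Fact p.Prime] (N : ℕ) (w : ℕ → ℕ)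
    (hw : w ∈ LimitWords.wordsOver N)
    (hper : ¬ LimitWords.IsPeriodic w)
    (hrec : LimitWords.IsUniformlyRecurrent w)
    (hcomp : ∃ C : ℕ, ∀ n : ℕ,
      ENat.card (LimitWords.factorGraph w n).ConnectedComponent ≤ (C : ℕ∞)) :
    ∀ x : LimitWords.PLine p, (w, x) ∉ LimitWords.LMad p := by
  rintro x ⟨ε, hε, hx⟩
  obtain ⟨C, hC⟩ := hcomp
  obtain ⟨v, hv, rfl⟩ := LimitWords.exists_unimodular_mk_eq x
  refine hper (LimitWords.isPeriodic_of_intForm_bounded (fun i => (hw i).1) hrec hC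
    (u := fun i => LimitWords.intAct (LimitWords.wordMat w 0 i) v) (fun i m => ?_) fun r hr => ?_)
  · rw [LimitWords.wordMat_add, LimitWords.intAct_mul, zero_add]
  · obtain ⟨h, hh⟩ := LimitWords.exists_not_dvd_intForm (p := p) hε hr
    refine ⟨h, fun i => hh _ (hv.intAct (LimitWords.isUnit_det_wordMat w 0 i)) ?_⟩
    have := (hx i).2
    rw [LimitWords.iterate_extShift w hv, LimitWords.mk_mem_PBad_iff] at this
    exact this
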